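/- Let $n\ge 1$ and let $x_1,\dots,x_{n+1}$ be distinct points of $[0,1]$. If $n$ is even put $g_1(x)=1$, $g_2(x)=x(1-x)$; if $n$ is odd put $g_1(x)=x$, $g_2(x)=1-x$. Let $w_1(x)=(1,x,\dots,x^{m_1-1})^t$ and $w_2(x)=(1,x,\dots,x^{m_2-1})^t$ with $m_1=k+1$, $m_2=k$ if $n=2k$ and $m_1=m_2=k+1$ if $n=2k+1$, and let $$B(x)=\begin{pmatrix} g_1(x)\,w_1(x)w_1(x)^t & 0\\ 0 & g_2(x)\,w_2(x)w_2(x)^t\end{pmatrix}\in\mathbb R^{(n+1)\times(n+1)} .$$ Let $\mathcal D$ be the set of $\lambda\in\mathbb R^{n+1}$ such that $I+\sum_{r=1}^{n+1}\lambda_r B(x_r)$ is positive definite, let $$C_\infty=\{\lambda\in\mathbb R^{n+1} \mid \mu+t\lambda\in\mathcal D \text{ for all } \mu\in\mathcal D,\ t\ge 0\}$$ be its asymptotic cone, and let $C_\infty^1=\{\lambda\in C_\infty \mid \sum_{r=1}^{n+1}\lambda_r=1\}$. Let $L(x)=(l_1(x),\dots,l_{n+1}(x))$ be the vector of values at $x$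 of the Lagrange interpolation polynomials of the points $x_1,\dots,x_{n+1}$, that is, $l_r$ is the polynomial of degree at most $n$ with $l_r(x_s)=\delta_{rs}$. Then $C_\infty^1$ is compact and, if $n\ge 2$, its set of extreme points is $$\mathrm{ext}(C_\infty^1)=\{L(x)\mid x\in[0,1]\}.$$ -/

import Mathlib

/-- The two weights attached to degree `n` on the segment `[0, 1]`:
`g₁ = 1`, `g₂ = X (1 - X)` for even `n`, and `g₁ = X`, `g₂ = 1 - X` for odd `n`.
This is `g₁`. -/
noncomputable def weightOne (n : ℕ) (t : ℝ) : ℝ := if Even n then 1 else t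

/-- The second weight `g₂`. -/
noncomputable def weightTwo (n : ℕ) (t : ℝ) : ℝ := if Even n then t * (1 - t) else 1 - t

/-- The vector of monomials `(1, t, …, t ^ (m - 1))`. -/
def monomialVec (m : ℕ) (t : ℝ) : Fin m → ℝ := fun i => t ^ (i : ℕ)

/-- Index set of the matrices `B t`. The first block has size `n / 2 + 1` and the second one
`(n + 1) / 2`, that is `k + 1` and `k` if `n = 2 k`, and `k + 1` and `k + 1` if `n = 2 k + 1`;
the total size is `n + 1`. -/
abbrev BlockIdx (n : ℕ) : Type := Fin (n / 2 + 1) ⊕ Fin ((n + 1) / 2)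

/-- The block diagonal localizing matrix
`B t = diag (g₁ t • w₁ ⊗ w₁, g₂ t • w₂ ⊗ w₂)`, where `w₁`, `w₂` are vectors of monomials at `t`. -/
noncomputable def localizingMatrix (n : ℕ) (t : ℝ) : Matrix (BlockIdx n) (BlockIdx n) ℝ :=
  Matrix.fromBlocks
    (weightOne n t • Matrix.vecMulVec (monomialVec (n / 2 + 1) t) (monomialVec (n / 2 + 1) t)) 0
    0 (weightTwo n t •
      Matrix.vecMulVec (monomialVec ((n + 1) / 2) t) (monomialVec ((n + 1) / 2) t))

/-- The domain `D` of those `lam ∈ ℝ^(n+1)` for which `I + ∑ r, lam r • B (x r)` is positive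
definite, `x` being the interpolation points. -/
def posDefDomain (n : ℕ) (x : Fin (n + 1) → ℝ) : Set (Fin (n + 1) → ℝ) :=
  {lam | ((1 : Matrix (BlockIdx n) (BlockIdx n) ℝ)
    + ∑ r, lam r • localizingMatrix n (x r)).PosDef}

/-- The asymptotic (recession) cone of a set `D`: the directions in which one can move
indefinitely from any point of `D` without leaving `D`. -/
def coneAtInfinity {E : Type*} [AddCommGroup E] [Module ℝ E] (D : Set E) : Set E :=
  {d | ∀ μ ∈ D, ∀ t : ℝ, 0 ≤ t → μ + t • d ∈ D}

/-- The slice `∑ r, lam r = 1` of the asymptotic cone of `posDefDomain n x`. -/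
def coneSlice (n : ℕ) (x : Fin (n + 1) → ℝ) : Set (Fin (n + 1) → ℝ) :=
  {lam | lam ∈ coneAtInfinity (posDefDomain n x) ∧ ∑ r, lam r = 1}

/-- The Lagrange vector at `t`: the values at `t` of the Lagrange interpolation polynomials
of the points `x`. -/
noncomputable def lagrangeVec (n : ℕ) (x : Fin (n + 1) → ℝ) (t : ℝ) : Fin (n + 1) → ℝ :=
  fun r => (Lagrange.basis Finset.univ x r).eval t

/-! Identify `lam` with the functional `P ↦ ∑ r, lam r * P (x r)` on polynomials of degree at most
`n`. It is a recession direction iff `∑ r, lam r • B (x r)` is positive semidefinite, that is, iff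
the functional is nonnegative on all `g₁ p²` and `g₂ q²` of degree at most `n`. By Lukács' theorem
(`LocalizingPos.apply_nonneg`) it is then nonnegative on every polynomial of degree at most `n` that
is nonnegative on `[0, 1]`.

The Lagrange vector at `t` is evaluation at `t`, so Hahn–Banach separation identifies the slice with
the convex hull of the curve of Lagrange vectors (`coneSlice_eq_convexHull`). This hull is compact
and its extreme points lie on the curve. Conversely, for `n ≥ 2` the polynomial `(X - t)²` is
admissible and vanishes only at `t`, which isolates the Lagrange vector at `t` as an extreme point.
-/

/-- The polynomial whose evaluation is `weightOne n`. -/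
noncomputable def weightOnePoly (n : ℕ) : Polynomial ℝ := if Even n then 1 else Polynomial.X

/-- The polynomial whose evaluation is `weightTwo n`. -/
noncomputable def weightTwoPoly (n : ℕ) : Polynomial ℝ :=
  if Even n then Polynomial.X * (1 - Polynomial.X) else 1 - Polynomial.X

/-- A linear functional on polynomials is localizing-positive in degree `n` if it is nonnegative
on weighted squares of degree at most `n`. -/
def LocalizingPos (n : ℕ) (F : Polynomial ℝ →ₗ[ℝ] ℝ) : Prop :=
  (∀ p : Polynomial ℝ, p.degree < ((n / 2 + 1 : ℕ) : WithBot ℕ) → 0 ≤ F (weightOnePoly n * p ^ 2)) ∧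
  ∀ q : Polynomial ℝ, q.degree < (((n + 1) / 2 : ℕ) : WithBot ℕ) → 0 ≤ F (weightTwoPoly n * q ^ 2)

/-! ### Lukács' theorem on `[0, 1]`, in dual form -/

section
open Polynomial

theorem degree_mul_lt_succ {l q : ℝ[X]} {N : ℕ} (hl : l.degree ≤ 1) (hq : q.degree < (N : WithBot ℕ)) :
    (l * q).degree < ((N + 1 : ℕ) : WithBot ℕ) := by
  rcases eq_or_ne q 0 with rfl | hq0
  · simp
  rcases eq_or_ne l 0 with rfl | hl0
  · simp
  rw [degree_lt_iff_coeff_zero] at *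
  have h1 : l.natDegree ≤ 1 := natDegree_le_of_degree_le hl
  intro m hm
  have h2 : q.natDegree < N := by
    by_contra h
    exact hq0 (leadingCoeff_eq_zero.mp (hq _ (not_lt.mp h)))
  exact coeff_eq_zero_of_natDegree_lt (natDegree_mul_le.trans_lt (by omega))

theorem degree_one_sub_X_le : (1 - X : ℝ[X]).degree ≤ 1 := by compute_degree

namespace LocalizingPos

variable {n : ℕ} {F : ℝ[X] →ₗ[ℝ] ℝ}

/-- The parity of the degree changes, and `X * gᵢ` is either the weight `gᵢ` of degree `n + 1` or
that weight times `X²`, which the square absorbs. -/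
theorem comp_mul_X (h : LocalizingPos (n + 1) F) :
    LocalizingPos n (F ∘ₗ LinearMap.mulLeft ℝ X) := by
  obtain ⟨h1, h2⟩ := h
  rcases Nat.even_or_odd' n with ⟨k, rfl | rfl⟩
  · have e1 : (2 * k + 1) / 2 = k := by omega
    have e2 : (2 * k + 1 + 1) / 2 = k + 1 := by omega
    have e3 : 2 * k / 2 = k := by omega
    simp only [weightOnePoly, weightTwoPoly, LocalizingPos, e1, e2, e3, Nat.even_add_one,
      even_two_mul, not_true_eq_false, if_true, if_false, LinearMap.comp_apply,
      LinearMap.mulLeft_apply] at *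
    refine ⟨fun p hp => ?_, fun q hq => ?_⟩
    · simpa using h1 p hp
    · convert h2 (X * q) (degree_mul_lt_succ degree_X_le hq) using 2
      ring
  · have e1 : (2 * k + 1) / 2 = k := by omega
    have e2 : (2 * k + 1 + 1) / 2 = k + 1 := by omega
    have e3 : (2 * k + 1 + 1 + 1) / 2 = k + 1 := by omega
    simp only [weightOnePoly, weightTwoPoly, LocalizingPos, e1, e2, e3, Nat.even_add_one,
      even_two_mul, not_true_eq_false, not_false_eq_true, if_true, if_false, LinearMap.comp_apply,
      LinearMap.mulLeft_apply] at *
    refine ⟨fun p hp => ?_, fun q hq => ?_⟩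
    · convert h1 (X * p) (degree_mul_lt_succ degree_X_le hp) using 2
      ring
    · simpa [mul_assoc] using h2 q hq

/-- As for `comp_mul_X`, except that multiplication by `1 - X` also exchanges the two weights. -/
theorem comp_mul_one_sub_X (h : LocalizingPos (n + 1) F) :
    LocalizingPos n (F ∘ₗ LinearMap.mulLeft ℝ (1 - X)) := by
  obtain ⟨h1, h2⟩ := h
  rcases Nat.even_or_odd' n with ⟨k, rfl | rfl⟩
  · have e1 : (2 * k + 1) / 2 = k := by omega
    have e2 : (2 * k + 1 + 1) / 2 = k + 1 := by omega
    have e3 : 2 * k / 2 = k := by omega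
    simp only [weightOnePoly, weightTwoPoly, LocalizingPos, e1, e2, e3, Nat.even_add_one,
      even_two_mul, not_true_eq_false, if_true, if_false, LinearMap.comp_apply,
      LinearMap.mulLeft_apply] at *
    refine ⟨fun p hp => ?_, fun q hq => ?_⟩
    · simpa only [one_mul] using h2 p hp
    · convert h1 ((1 - X) * q) (degree_mul_lt_succ degree_one_sub_X_le hq) using 2
      ring
  · have e1 : (2 * k + 1) / 2 = k := by omega
    have e2 : (2 * k + 1 + 1) / 2 = k + 1 := by omega
    have e3 : (2 * k + 1 + 1 + 1) / 2 = k + 1 := by omega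
    simp only [weightOnePoly, weightTwoPoly, LocalizingPos, e1, e2, e3, Nat.even_add_one,
      even_two_mul, not_true_eq_false, not_false_eq_true, if_true, if_false, LinearMap.comp_apply,
      LinearMap.mulLeft_apply] at *
    refine ⟨fun p hp => ?_, fun q hq => ?_⟩
    · convert h2 p hp using 2
      ring
    · convert h1 ((1 - X) * q) (degree_mul_lt_succ degree_one_sub_X_le hq) using 2
      ring

theorem comp_mul_sq (h : LocalizingPos (n + 2) F) (a : ℝ) :
    LocalizingPos n (F ∘ₗ LinearMap.mulLeft ℝ ((X - C a) ^ 2)) := by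
  obtain ⟨h1, h2⟩ := h
  have e1 : (n + 2) / 2 = n / 2 + 1 := by omega
  have e2 : (n + 2 + 1) / 2 = (n + 1) / 2 + 1 := by omega
  have e3 : Even (n + 2) ↔ Even n := by simp [Nat.even_add]
  simp only [weightOnePoly, weightTwoPoly, LocalizingPos, e1, e2, e3, LinearMap.comp_apply,
      LinearMap.mulLeft_apply] at *
  refine ⟨fun p hp => ?_, fun q hq => ?_⟩
  · convert h1 ((X - C a) * p) (degree_mul_lt_succ (degree_X_sub_C_le a) hp) using 2
    ring
  · convert h2 ((X - C a) * q) (degree_mul_lt_succ (degree_X_sub_C_le a) hq) using 2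
    ring

/-- For odd `n` this is `1 = X + (1 - X)`, the sum of the two weights. -/
theorem apply_one_nonneg (h : LocalizingPos n F) : 0 ≤ F 1 := by
  obtain ⟨h1, h2⟩ := h
  have hd : ∀ m : ℕ, (1 : ℝ[X]).degree < ((m + 1 : ℕ) : WithBot ℕ) := fun m => by
    rw [degree_one]; exact_mod_cast Nat.succ_pos m
  have h1 := h1 1 (hd _)
  rcases Nat.even_or_odd' n with ⟨k, rfl | rfl⟩
  · simpa [weightOnePoly] using h1
  · have h2 := h2 1 (by convert hd k using 3; omega)
    simp [weightOnePoly, weightTwoPoly] at h1 h2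
    linarith

end LocalizingPos

/-- If a product with a factor positive on `[0, 1]` off one point is nonnegative on `[0, 1]`,
then so is the other factor. -/
theorem eval_nonneg_of_mul {l Q : ℝ[X]} {a : ℝ}
    (hl : ∀ t ∈ Set.Icc (0 : ℝ) 1, t ≠ a → 0 < l.eval t)
    (h : ∀ t ∈ Set.Icc (0 : ℝ) 1, 0 ≤ (l * Q).eval t) :
    ∀ t ∈ Set.Icc (0 : ℝ) 1, 0 ≤ Q.eval t := by
  -- Division by `l` settles the points other than `a`; continuity of `Q` gives the rest.
  have hIcc : Set.Icc (0 : ℝ) 1 ⊆ closure (Set.Ioo 0 1 \ {a}) := by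
    rw [← closure_Ioo (zero_ne_one' ℝ)]
    refine closure_minimal ?_ isClosed_closure
    have := (dense_compl_singleton a).open_subset_closure_inter (isOpen_Ioo (a := (0 : ℝ)) (b := 1))
    rwa [Set.sdiff_eq]
  have hcl : IsClosed {t : ℝ | 0 ≤ Q.eval t} := isClosed_le continuous_const Q.continuous
  refine fun t ht => closure_minimal ?_ hcl (hIcc ht)
  intro s hs
  have hs' := Set.Ioo_subset_Icc_self hs.1
  have := h s hs'
  rw [eval_mul] at this
  exact nonneg_of_mul_nonneg_right this (hl s hs' hs.2)

/-- Lukács' theorem in dual form. -/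
theorem LocalizingPos.apply_nonneg {n : ℕ} : ∀ {F : ℝ[X] →ₗ[ℝ] ℝ}, LocalizingPos n F →
    ∀ {P : ℝ[X]}, P.natDegree ≤ n → (∀ t ∈ Set.Icc (0 : ℝ) 1, 0 ≤ P.eval t) → 0 ≤ F P := by
  induction n using Nat.strong_induction_on with
  | _ n ih =>
  intro F hF P hdeg hP
  obtain ⟨a, ha, hmin⟩ := isCompact_Icc.exists_isMinOn (Set.nonempty_Icc.2 (zero_le_one' ℝ))
    P.continuous.continuousOn
  -- Subtracting the minimum creates a root in `[0, 1]`. A factor of `R` is then moved from the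
  -- polynomial into the functional, which lowers the degree; no decomposition into squares is ever
  -- written down.
  set R := P - C (P.eval a) with hR
  have hPR : P = R + (P.eval a) • (1 : ℝ[X]) := by rw [hR, smul_eq_C_mul]; ring
  have hR0 : ∀ t ∈ Set.Icc (0 : ℝ) 1, 0 ≤ R.eval t := fun t ht => by
    simpa [hR] using isMinOn_iff.1 hmin t ht
  have hRdeg : R.natDegree ≤ n := by rw [hR, natDegree_sub_C]; exact hdeg
  have hroot : R.IsRoot a := by simp [hR]
  suffices 0 ≤ F R by
    rw [hPR, map_add, map_smul, smul_eq_mul]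
    exact add_nonneg this (mul_nonneg (hP a ha) hF.apply_one_nonneg)
  rcases eq_or_ne R 0 with h0 | h0
  · simp [h0]
  have key : ∀ l Q : ℝ[X], R = l * Q → l ≠ 0 ∧ Q ≠ 0 ∧ l.natDegree + Q.natDegree ≤ n := by
    rintro l Q h
    have hl : l ≠ 0 := by rintro rfl; simp [h] at h0
    have hQ : Q ≠ 0 := by rintro rfl; simp [h] at h0
    refine ⟨hl, hQ, ?_⟩
    rw [← natDegree_mul hl hQ, ← h]
    exact hRdeg
  rcases eq_or_lt_of_le ha.1 with rfl | ha0
  · obtain ⟨Q, hQ⟩ := dvd_iff_isRoot.2 hroot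
    rw [C_0, sub_zero] at hQ
    obtain ⟨-, -, hd⟩ := key _ _ hQ
    rw [natDegree_X] at hd
    obtain ⟨m, rfl⟩ := Nat.exists_eq_add_of_le' (show 1 ≤ n by omega)
    have := ih m (by omega) hF.comp_mul_X (P := Q) (by omega)
      (eval_nonneg_of_mul (l := X) (a := 0)
        (fun t ht h => by rw [eval_X]; exact lt_of_le_of_ne ht.1 h.symm) (hQ ▸ hR0))
    rw [hQ]
    simpa using this
  rcases eq_or_lt_of_le ha.2 with rfl | ha1
  · obtain ⟨Q, hQ⟩ := dvd_iff_isRoot.2 hroot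
    -- The sign is chosen so that the linear factor is nonnegative on `[0, 1]`.
    replace hQ : R = (1 - X) * (-Q) := by rw [hQ, C_1]; ring
    obtain ⟨-, -, hd⟩ := key _ _ hQ
    have h1 : (1 - X : ℝ[X]).natDegree = 1 := by compute_degree!
    rw [h1] at hd
    obtain ⟨m, rfl⟩ := Nat.exists_eq_add_of_le' (show 1 ≤ n by omega)
    have := ih m (by omega) hF.comp_mul_one_sub_X (P := -Q) (by omega)
      (eval_nonneg_of_mul (l := 1 - X) (a := 1)
        (fun t ht h => by simpa using lt_of_le_of_ne ht.2 h) (hQ ▸ hR0))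
    rw [hQ]
    simpa only [LinearMap.comp_apply, LinearMap.mulLeft_apply] using this
  -- An interior minimum is a critical point, so `a` is at least a double root.
  · have hloc : IsLocalMin (fun t => P.eval t) a := hmin.isLocalMin (Icc_mem_nhds ha0 ha1)
    have hder : (derivative R).IsRoot a := by
      simpa [hR, IsRoot] using hloc.deriv_eq_zero
    have hmult := (one_lt_rootMultiplicity_iff_isRoot h0).2 ⟨hroot, hder⟩
    obtain ⟨Q, hQ⟩ := (le_rootMultiplicity_iff h0).1 hmult
    obtain ⟨-, -, hd⟩ := key _ _ hQ
    rw [natDegree_pow, natDegree_X_sub_C] at hd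
    obtain ⟨m, rfl⟩ := Nat.exists_eq_add_of_le' (show 2 ≤ n by omega)
    have := ih m (by omega) (hF.comp_mul_sq a) (P := Q) (by omega)
      (eval_nonneg_of_mul (l := (X - C a) ^ 2) (a := a)
        (fun t ht h => by
          have : t - a ≠ 0 := sub_ne_zero.2 h
          simp only [eval_pow, eval_sub, eval_X, eval_C]; positivity) (hQ ▸ hR0))
    rw [hQ]
    simpa only [LinearMap.comp_apply, LinearMap.mulLeft_apply] using this

end

/-! ### Compactness of convex hulls -/

/-- In finite dimension the convex hull of a compact set is compact. -/
theorem IsCompact.isCompact_convexHull {E : Type*} [AddCommGroup E] [Module ℝ E]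
    [TopologicalSpace E] [ContinuousAdd E] [ContinuousSMul ℝ E] [FiniteDimensional ℝ E]
    {s : Set E} (hs : IsCompact s) : IsCompact (convexHull ℝ s) := by
  rcases s.eq_empty_or_nonempty with rfl | ⟨z₀, hz₀⟩
  · simp
  -- Carathéodory: this many points suffice, so the hull is a continuous image of the compact set
  -- `stdSimplex × s ^ N`.
  let N := Module.finrank ℝ E + 1
  have hcomp : IsCompact ((fun q : (Fin N → ℝ) × (Fin N → E) => ∑ i, q.1 i • q.2 i) ''
      (stdSimplex ℝ (Fin N) ×ˢ Set.univ.pi fun _ => s)) :=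
    ((isCompact_stdSimplex ℝ (Fin N)).prod (isCompact_univ_pi fun _ => hs)).image (by fun_prop)
  convert hcomp using 1
  refine Set.Subset.antisymm (fun y hy => ?_) ?_
  · obtain ⟨ι, _, z, w, hz, hind, hw, hw1, rfl⟩ := eq_pos_convex_span_of_mem_convexHull hy
    have hcard : Fintype.card ι ≤ Fintype.card (Fin N) := by
      rw [Fintype.card_fin]
      exact hind.card_le_finrank_succ.trans (Nat.succ_le_succ (Submodule.finrank_le _))
    obtain ⟨e⟩ := Function.Embedding.nonempty_of_card_le hcard
    -- Shorter combinations are padded with weight `0` at the dummy point `z₀`.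
    refine ⟨(Function.extend e w 0, Function.extend e z fun _ => z₀), ⟨⟨fun j => ?_, ?_⟩, ?_⟩, ?_⟩
    · by_cases h : ∃ i, e i = j
      · obtain ⟨i, rfl⟩ := h
        simpa [e.injective.extend_apply] using (hw i).le
      · simp [Function.extend_apply' _ _ _ h]
    · rw [← hw1]
      refine (Fintype.sum_of_injective e e.injective _ _ (fun j hj => ?_) fun i => ?_).symm
      · exact Function.extend_apply' _ _ _ hj
      · exact (e.injective.extend_apply _ _ _).symm
    · intro j _
      by_cases h : ∃ i, e i = j
      · obtain ⟨i, rfl⟩ := h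
        simpa [e.injective.extend_apply] using hz ⟨i, rfl⟩
      · simpa [Function.extend_apply' _ _ _ h] using hz₀
    · refine (Fintype.sum_of_injective e e.injective _ _ (fun j hj => ?_) fun i => ?_).symm
      · simp [Function.extend_apply' _ _ _ hj]
      · simp [e.injective.extend_apply]
  · rintro _ ⟨⟨w, z⟩, ⟨hw, hz⟩, rfl⟩
    exact mem_convexHull_of_exists_fintype w z hw.1 hw.2 (fun i => hz i trivial) rfl

/-! ### The asymptotic cone as a dual cone of polynomials -/

section
open Polynomial Matrix

/-- The functional `P ↦ ∑ r, lam r * P (x r)`. -/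
noncomputable def nodeFunctional {ι : Type*} [Fintype ι] (x lam : ι → ℝ) : ℝ[X] →ₗ[ℝ] ℝ :=
  ∑ r, lam r • leval (x r)

theorem nodeFunctional_apply {ι : Type*} [Fintype ι] (x lam : ι → ℝ) (P : ℝ[X]) :
    nodeFunctional x lam P = ∑ r, lam r * P.eval (x r) := by
  simp [nodeFunctional, LinearMap.sum_apply]

/-- The polynomial with coefficient vector `u`. -/
noncomputable def coeffPoly {m : ℕ} (u : Fin m → ℝ) : ℝ[X] := ∑ i, C (u i) * X ^ (i : ℕ)

theorem eval_coeffPoly {m : ℕ} (u : Fin m → ℝ) (t : ℝ) :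
    (coeffPoly u).eval t = monomialVec m t ⬝ᵥ u := by
  simp only [coeffPoly, eval_finsetSum, dotProduct, monomialVec, eval_mul, eval_C, eval_pow, eval_X]
  exact Finset.sum_congr rfl fun _ _ => mul_comm _ _

theorem degree_coeffPoly_lt {m : ℕ} (u : Fin m → ℝ) : (coeffPoly u).degree < (m : WithBot ℕ) :=
  degree_sum_fin_lt u

theorem exists_coeffPoly_eq {m : ℕ} {p : ℝ[X]} (hp : p.degree < (m : WithBot ℕ)) :
    ∃ u : Fin m → ℝ, coeffPoly u = p := by
  refine ⟨fun i => p.coeff i, ?_⟩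
  rw [coeffPoly, Fin.sum_univ_eq_sum_range (fun i => C (p.coeff i) * X ^ i)]
  ext j
  simp only [finsetSum_coeff, coeff_C_mul, coeff_X_pow, mul_ite, mul_one, mul_zero,
    Finset.sum_ite_eq, Finset.mem_range]
  split_ifs with h
  · rfl
  · exact (coeff_eq_zero_of_degree_lt (hp.trans_le (by exact_mod_cast not_lt.1 h))).symm

theorem eval_weightOnePoly (n : ℕ) (t : ℝ) : (weightOnePoly n).eval t = weightOne n t := by
  unfold weightOnePoly weightOne; split_ifs <;> simp

theorem eval_weightTwoPoly (n : ℕ) (t : ℝ) : (weightTwoPoly n).eval t = weightTwo n t := by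
  unfold weightTwoPoly weightTwo; split_ifs <;> simp

/-- The polynomial whose value at `t` is the quadratic form of `localizingMatrix n t` at `v`. -/
noncomputable def quadPoly (n : ℕ) (v : BlockIdx n → ℝ) : ℝ[X] :=
  weightOnePoly n * coeffPoly (v ∘ Sum.inl) ^ 2 + weightTwoPoly n * coeffPoly (v ∘ Sum.inr) ^ 2

theorem dotProduct_localizingMatrix_mulVec (n : ℕ) (t : ℝ) (v : BlockIdx n → ℝ) :
    v ⬝ᵥ (localizingMatrix n t *ᵥ v) = (quadPoly n v).eval t := by
  have hv : v ⬝ᵥ (localizingMatrix n t *ᵥ v) =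
      Sum.elim (v ∘ Sum.inl) (v ∘ Sum.inr) ⬝ᵥ (localizingMatrix n t *ᵥ v) := by
    rw [Sum.elim_comp_inl_inr]
  rw [hv, localizingMatrix, fromBlocks_mulVec, sumElim_dotProduct_sumElim]
  simp only [quadPoly, eval_add, eval_mul, eval_pow, eval_weightOnePoly, eval_weightTwoPoly,
    eval_coeffPoly, zero_mulVec, add_zero, zero_add, smul_mulVec, vecMulVec_mulVec,
    dotProduct_smul, smul_eq_mul, op_smul_eq_smul]
  rw [dotProduct_comm (v ∘ Sum.inl), dotProduct_comm (v ∘ Sum.inr)]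
  ring

theorem dotProduct_sum_localizingMatrix_mulVec (n : ℕ) (x lam : Fin (n + 1) → ℝ)
    (v : BlockIdx n → ℝ) :
    v ⬝ᵥ ((∑ r, lam r • localizingMatrix n (x r)) *ᵥ v) = nodeFunctional x lam (quadPoly n v) := by
  simp only [nodeFunctional_apply, sum_mulVec, dotProduct_sum, smul_mulVec, dotProduct_smul,
    dotProduct_localizingMatrix_mulVec, smul_eq_mul]

theorem isHermitian_localizingMatrix (n : ℕ) (t : ℝ) : (localizingMatrix n t).IsHermitian := by
  unfold localizingMatrix
  refine IsHermitian.fromBlocks ?_ (by simp) ?_ <;>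
  · ext i j
    simp [vecMulVec_apply, mul_comm]

theorem mem_posDefDomain_iff {n : ℕ} {x lam : Fin (n + 1) → ℝ} :
    lam ∈ posDefDomain n x ↔
      ∀ v : BlockIdx n → ℝ, v ≠ 0 → 0 < v ⬝ᵥ v + nodeFunctional x lam (quadPoly n v) := by
  have hherm : ((1 : Matrix (BlockIdx n) (BlockIdx n) ℝ)
      + ∑ r, lam r • localizingMatrix n (x r)).IsHermitian := by
    refine isHermitian_one.add ?_
    rw [IsHermitian, conjTranspose_sum]
    exact Finset.sum_congr rfl fun r _ => by
      rw [conjTranspose_smul, (isHermitian_localizingMatrix n (x r)).eq, star_trivial]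
  rw [posDefDomain, Set.mem_ofPred_eq, posDef_iff_dotProduct_mulVec]
  simp only [hherm, true_and, star_trivial, add_mulVec, one_mulVec, dotProduct_add,
    dotProduct_sum_localizingMatrix_mulVec]

theorem nodeFunctional_add {ι : Type*} [Fintype ι] (x lam mu : ι → ℝ) (P : ℝ[X]) :
    nodeFunctional x (lam + mu) P = nodeFunctional x lam P + nodeFunctional x mu P := by
  simp [nodeFunctional_apply, add_mul, Finset.sum_add_distrib]

theorem nodeFunctional_smul {ι : Type*} [Fintype ι] (x lam : ι → ℝ) (c : ℝ) (P : ℝ[X]) :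
    nodeFunctional x (c • lam) P = c * nodeFunctional x lam P := by
  simp [nodeFunctional_apply, Finset.mul_sum, mul_assoc]

theorem coneAtInfinity_posDefDomain_iff_quadPoly {n : ℕ} {x lam : Fin (n + 1) → ℝ} :
    lam ∈ coneAtInfinity (posDefDomain n x) ↔
      ∀ v : BlockIdx n → ℝ, 0 ≤ nodeFunctional x lam (quadPoly n v) := by
  constructor
  · intro h v
    have h0 : (0 : Fin (n + 1) → ℝ) ∈ posDefDomain n x :=
      mem_posDefDomain_iff.2 fun v hv => by
        have : 0 < v ⬝ᵥ v := by simpa using (dotProduct_star_self_pos_iff (v := v)).2 hv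
        simpa [nodeFunctional_apply] using this
    rcases eq_or_ne v 0 with rfl | hv
    · simp [quadPoly, coeffPoly]
    by_contra! hneg
    have hvv : 0 ≤ v ⬝ᵥ v := by simpa using dotProduct_star_self_nonneg v
    -- Starting from `0` in the domain, this is the time at which the quadratic form at `v` reaches
    -- exactly `0`.
    have ht : 0 ≤ (v ⬝ᵥ v) / -(nodeFunctional x lam (quadPoly n v)) :=
      div_nonneg hvv (by linarith)
    have := mem_posDefDomain_iff.1 (h 0 h0 _ ht) v hv
    rw [zero_add, nodeFunctional_smul, div_neg, neg_mul, div_mul_cancel₀ _ hneg.ne] at this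
    linarith
  · intro h mu hmu t ht
    refine mem_posDefDomain_iff.2 fun v hv => ?_
    have := mem_posDefDomain_iff.1 hmu v hv
    rw [nodeFunctional_add, nodeFunctional_smul]
    linarith [mul_nonneg ht (h v)]

theorem mem_coneAtInfinity_posDefDomain_iff {n : ℕ} {x lam : Fin (n + 1) → ℝ} :
    lam ∈ coneAtInfinity (posDefDomain n x) ↔ LocalizingPos n (nodeFunctional x lam) := by
  rw [coneAtInfinity_posDefDomain_iff_quadPoly]
  constructor
  · refine fun h => ⟨fun p hp => ?_, fun q hq => ?_⟩
    -- Vectors supported on a single block isolate a single weighted square.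
    · obtain ⟨u, rfl⟩ := exists_coeffPoly_eq hp
      simpa [quadPoly, coeffPoly] using h (Sum.elim u 0)
    · obtain ⟨u, rfl⟩ := exists_coeffPoly_eq hq
      simpa [quadPoly, coeffPoly] using h (Sum.elim 0 u)
  · intro h v
    rw [quadPoly, map_add]
    exact add_nonneg (h.1 _ (degree_coeffPoly_lt _)) (h.2 _ (degree_coeffPoly_lt _))

theorem natDegree_quadPoly_le (n : ℕ) (v : BlockIdx n → ℝ) : (quadPoly n v).natDegree ≤ n := by
  have hdeg : ∀ {N m : ℕ} (u : Fin N → ℝ), N = m + 1 → (coeffPoly u).natDegree ≤ m :=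
    fun {N m} u h => natDegree_le_iff_coeff_eq_zero.2 fun j hj =>
      (degree_lt_iff_coeff_zero _ _).1 (degree_coeffPoly_lt u) j (by omega)
  have hX : (1 - X : ℝ[X]).natDegree = 1 := by compute_degree!
  have h1 := hdeg (v ∘ Sum.inl) rfl
  have h1' : (coeffPoly (v ∘ Sum.inl) ^ 2).natDegree ≤ 2 * (n / 2) := natDegree_pow_le_of_le 2 h1
  refine natDegree_add_le_of_degree_le ?_ ?_
  · refine natDegree_mul_le.trans ?_
    unfold weightOnePoly
    split_ifs with hn
    · rw [natDegree_one]; omega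
    · have := Nat.odd_iff.1 (Nat.not_even_iff_odd.1 hn)
      rw [natDegree_X]; omega
  -- For `n = 0` the second block is empty; adding degrees would give only the bound `2`, coming
  -- from the weight.
  · rcases Nat.eq_zero_or_pos ((n + 1) / 2) with h0 | h0
    · have : coeffPoly (v ∘ Sum.inr) = 0 := by
        have : IsEmpty (Fin ((n + 1) / 2)) := by rw [h0]; infer_instance
        simp [coeffPoly]
      simp [this]
    obtain ⟨m, hm⟩ := Nat.exists_eq_add_of_le' h0
    have h2 : (coeffPoly (v ∘ Sum.inr)).natDegree ≤ m := hdeg _ hm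
    have h2' : (coeffPoly (v ∘ Sum.inr) ^ 2).natDegree ≤ 2 * m := natDegree_pow_le_of_le 2 h2
    refine natDegree_mul_le.trans ?_
    unfold weightTwoPoly
    split_ifs with hn
    · have := Nat.even_iff.1 hn
      have h3 : (X * (1 - X) : ℝ[X]).natDegree ≤ 1 + 1 :=
        natDegree_mul_le_of_le natDegree_X_le hX.le
      omega
    · have := Nat.odd_iff.1 (Nat.not_even_iff_odd.1 hn)
      omega

theorem eval_quadPoly_nonneg (n : ℕ) (v : BlockIdx n → ℝ) {t : ℝ} (ht : t ∈ Set.Icc (0 : ℝ) 1) :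
    0 ≤ (quadPoly n v).eval t := by
  have h1 : 0 ≤ weightOne n t := by
    unfold weightOne; split_ifs; exacts [zero_le_one, ht.1]
  have h2 : 0 ≤ weightTwo n t := by
    have := sub_nonneg.2 ht.2
    unfold weightTwo; split_ifs; exacts [mul_nonneg ht.1 this, this]
  simp only [quadPoly, eval_add, eval_mul, eval_pow, eval_weightOnePoly, eval_weightTwoPoly]
  positivity

/-- The cone at infinity is dual to the polynomials of degree at most `n` that are nonnegative
on `[0, 1]`. -/
theorem mem_coneAtInfinity_posDefDomain_iff_forall_polynomial {n : ℕ} {x lam : Fin (n + 1) → ℝ} :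
    lam ∈ coneAtInfinity (posDefDomain n x) ↔ ∀ P : ℝ[X], P.natDegree ≤ n →
      (∀ t ∈ Set.Icc (0 : ℝ) 1, 0 ≤ P.eval t) → 0 ≤ nodeFunctional x lam P :=
  ⟨fun h _ hd hP => (mem_coneAtInfinity_posDefDomain_iff.1 h).apply_nonneg hd hP,
    fun h => coneAtInfinity_posDefDomain_iff_quadPoly.2 fun v =>
      h _ (natDegree_quadPoly_le n v) fun _ ht => eval_quadPoly_nonneg n v ht⟩

/-! ### The slice as a convex hull, and its extreme points -/

/-- Lagrange interpolation: the functional of the Lagrange vector at `t` is evaluation at `t`. -/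
theorem nodeFunctional_lagrangeVec {n : ℕ} {x : Fin (n + 1) → ℝ} (hx : Function.Injective x)
    (t : ℝ) {P : ℝ[X]} (hP : P.natDegree ≤ n) :
    nodeFunctional x (lagrangeVec n x t) P = P.eval t := by
  have hlt : P.degree < ((Finset.univ : Finset (Fin (n + 1))).card : WithBot ℕ) := by
    rw [Finset.card_univ, Fintype.card_fin]
    exact (degree_le_of_natDegree_le hP).trans_lt (by exact_mod_cast Nat.lt_succ_self n)
  conv_rhs => rw [Lagrange.eq_interpolate (v := x) hx.injOn hlt]
  simp [nodeFunctional_apply, lagrangeVec, Lagrange.interpolate_apply, eval_finsetSum, mul_comm]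

theorem continuous_lagrangeVec (n : ℕ) (x : Fin (n + 1) → ℝ) : Continuous (lagrangeVec n x) :=
  continuous_pi fun _ => Polynomial.continuous _

theorem convex_coneSlice (n : ℕ) (x : Fin (n + 1) → ℝ) : Convex ℝ (coneSlice n x) := by
  rintro lam ⟨h1, h2⟩ mu ⟨h3, h4⟩ a b ha hb hab
  rw [mem_coneAtInfinity_posDefDomain_iff_forall_polynomial] at h1 h3
  refine ⟨mem_coneAtInfinity_posDefDomain_iff_forall_polynomial.2 fun P hd hP => ?_, ?_⟩
  · rw [nodeFunctional_add, nodeFunctional_smul, nodeFunctional_smul]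
    exact add_nonneg (mul_nonneg ha (h1 P hd hP)) (mul_nonneg hb (h3 P hd hP))
  · simp [Finset.sum_add_distrib, ← Finset.mul_sum, h2, h4, hab]

theorem lagrangeVec_mem_coneSlice {n : ℕ} {x : Fin (n + 1) → ℝ} (hx : Function.Injective x)
    {t : ℝ} (ht : t ∈ Set.Icc (0 : ℝ) 1) : lagrangeVec n x t ∈ coneSlice n x := by
  refine ⟨mem_coneAtInfinity_posDefDomain_iff_forall_polynomial.2 fun P hd hP => ?_, ?_⟩
  · rw [nodeFunctional_lagrangeVec hx t hd]
    exact hP t ht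
  · simpa [nodeFunctional_apply] using
      nodeFunctional_lagrangeVec hx t (P := 1) (by simp)

theorem isCompact_convexHull_lagrangeVec (n : ℕ) (x : Fin (n + 1) → ℝ) :
    IsCompact (convexHull ℝ (lagrangeVec n x '' Set.Icc (0 : ℝ) 1)) :=
  (isCompact_Icc.image (continuous_lagrangeVec n x)).isCompact_convexHull

/-- A linear form `f` separating `lam` from the hull is itself a polynomial: with `Q` interpolating
the coefficients of `f` at the nodes, `f` takes the value `Q t` at the Lagrange vector of `t`. Hence
`Q - u ≥ 0` on `[0, 1]`, and the dual description of the cone with `∑ r, lam r = 1` gives `f lam ≥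
u`, a contradiction. -/
theorem coneSlice_eq_convexHull {n : ℕ} {x : Fin (n + 1) → ℝ} (hx : Function.Injective x) :
    coneSlice n x = convexHull ℝ (lagrangeVec n x '' Set.Icc (0 : ℝ) 1) := by
  refine Set.Subset.antisymm (fun lam hlam => ?_) (convexHull_min ?_ (convex_coneSlice n x))
  · by_contra hnot
    obtain ⟨f, u, hfu, hf⟩ := geometric_hahn_banach_point_closed (convex_convexHull ℝ _)
      (isCompact_convexHull_lagrangeVec n x).isClosed hnot
    have hfsum : ∀ y : Fin (n + 1) → ℝ, f y = ∑ r, y r * f (Pi.single r 1) := fun y => by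
      conv_lhs => rw [pi_eq_sum_univ' y]
      simp [map_sum]
    set Q : ℝ[X] := Lagrange.interpolate Finset.univ x fun r => f (Pi.single r 1) with hQ
    have hQx : ∀ r, Q.eval (x r) = f (Pi.single r 1) := fun r =>
      Lagrange.eval_interpolate_at_node _ hx.injOn (Finset.mem_univ r)
    have hQf : ∀ y, nodeFunctional x y Q = f y := fun y => by
      simp only [nodeFunctional_apply, hQx, hfsum y]
    have hQdeg : Q.natDegree ≤ n := by
      have := Lagrange.degree_interpolate_le (s := Finset.univ) (v := x)
        (fun r => f (Pi.single r 1)) hx.injOn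
      refine natDegree_le_of_degree_le ?_
      rwa [Finset.card_univ, Fintype.card_fin, Nat.add_sub_cancel] at this
    have hpos := mem_coneAtInfinity_posDefDomain_iff_forall_polynomial.1 hlam.1 (Q - C u)
      (by rwa [natDegree_sub_C]) fun t ht => by
        have := hf _ (subset_convexHull ℝ _ (Set.mem_image_of_mem _ ht))
        rw [← hQf, nodeFunctional_lagrangeVec hx t hQdeg] at this
        simpa using this.le
    rw [map_sub, hQf] at hpos
    have hu : nodeFunctional x lam (C u) = u := by
      simp [nodeFunctional_apply, ← Finset.sum_mul, hlam.2]
    linarith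
  · rintro _ ⟨t, ht, rfl⟩
    exact lagrangeVec_mem_coneSlice hx ht

/-- Write `lam` as an average of Lagrange vectors at points `s i` with weights `w i`. The functional
at `(X - t)²` is `∑ i, w i * (s i - t)²`, so its vanishing puts all the weight on `s i = t`. The
bound `2 ≤ n` makes `(X - t)²` a polynomial on which interpolation is exact. -/
theorem eq_lagrangeVec_of_nodeFunctional_sq_eq_zero {n : ℕ} (hn : 2 ≤ n) {x : Fin (n + 1) → ℝ}
    (hx : Function.Injective x) {t : ℝ} {lam : Fin (n + 1) → ℝ} (hlam : lam ∈ coneSlice n x)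
    (h : nodeFunctional x lam ((X - C t) ^ 2) = 0) : lam = lagrangeVec n x t := by
  rw [coneSlice_eq_convexHull hx, mem_convexHull_iff_exists_fintype] at hlam
  obtain ⟨ι, _, w, z, hw, hw1, hz, rfl⟩ := hlam
  choose s hs hsz using hz
  have hdeg : ((X - C t) ^ 2 : ℝ[X]).natDegree ≤ n := by
    rw [natDegree_pow, natDegree_X_sub_C]; omega
  have hsum : nodeFunctional x (∑ i, w i • z i) ((X - C t) ^ 2) = ∑ i, w i * (s i - t) ^ 2 := by
    have : ∀ i, nodeFunctional x (z i) ((X - C t) ^ 2) = (s i - t) ^ 2 := fun i => by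
      rw [← hsz, nodeFunctional_lagrangeVec hx _ hdeg]; simp
    simp_rw [← this, ← nodeFunctional_smul]
    simp only [nodeFunctional_apply, Finset.sum_apply, Finset.sum_mul]
    exact Finset.sum_comm
  rw [hsum, Finset.sum_eq_zero_iff_of_nonneg fun i _ => mul_nonneg (hw i) (sq_nonneg _)] at h
  have hterm : ∀ i, w i • z i = w i • lagrangeVec n x t := fun i => by
    rcases mul_eq_zero.1 (h i (Finset.mem_univ i)) with h0 | h0
    · simp [h0]
    · rw [← hsz, sub_eq_zero.1 (pow_eq_zero_iff two_ne_zero |>.1 h0)]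
  rw [Finset.sum_congr rfl fun i _ => hterm i, ← Finset.sum_smul, hw1, one_smul]

/-- Pairing with `(X - t)²` is nonnegative on the slice and zero at this vector, hence zero at both
ends of any open segment of the slice through it. -/
theorem lagrangeVec_mem_extremePoints {n : ℕ} (hn : 2 ≤ n) {x : Fin (n + 1) → ℝ}
    (hx : Function.Injective x) {t : ℝ} (ht : t ∈ Set.Icc (0 : ℝ) 1) :
    lagrangeVec n x t ∈ Set.extremePoints ℝ (coneSlice n x) := by
  have hdeg : ((X - C t) ^ 2 : ℝ[X]).natDegree ≤ n := by
    rw [natDegree_pow, natDegree_X_sub_C]; omega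
  have hnonneg : ∀ lam ∈ coneSlice n x, 0 ≤ nodeFunctional x lam ((X - C t) ^ 2) :=
    fun lam hlam => mem_coneAtInfinity_posDefDomain_iff_forall_polynomial.1 hlam.1 _ hdeg
      fun s _ => by simpa using sq_nonneg (s - t)
  refine mem_extremePoints.2 ⟨lagrangeVec_mem_coneSlice hx ht, ?_⟩
  rintro lam hlam mu hmu ⟨a, b, ha, hb, -, heq⟩
  have h0 : a * nodeFunctional x lam ((X - C t) ^ 2)
      + b * nodeFunctional x mu ((X - C t) ^ 2) = 0 := by
    rw [← nodeFunctional_smul, ← nodeFunctional_smul, ← nodeFunctional_add, heq,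
      nodeFunctional_lagrangeVec hx t hdeg]
    simp
  have h1 := mul_nonneg ha.le (hnonneg lam hlam)
  have h2 := mul_nonneg hb.le (hnonneg mu hmu)
  exact ⟨eq_lagrangeVec_of_nodeFunctional_sq_eq_zero hn hx hlam
      ((mul_eq_zero.1 (by linarith)).resolve_left ha.ne'),
    eq_lagrangeVec_of_nodeFunctional_sq_eq_zero hn hx hmu
      ((mul_eq_zero.1 (by linarith)).resolve_left hb.ne')⟩

end

theorem propositionp (n : ℕ) (hn : 1 ≤ n) (x : Fin (n + 1) → ℝ)
    (hx : Function.Injective x) (hx01 : ∀ r, x r ∈ Set.Icc (0 : ℝ) 1) :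
    IsCompact (coneSlice n x) ∧
      (2 ≤ n → Set.extremePoints ℝ (coneSlice n x) = lagrangeVec n x '' Set.Icc (0 : ℝ) 1) := by
  refine ⟨?_, fun h2 => Set.Subset.antisymm ?_ ?_⟩
  · rw [coneSlice_eq_convexHull hx]
    exact isCompact_convexHull_lagrangeVec n x
  · rw [coneSlice_eq_convexHull hx]
    exact extremePoints_convexHull_subset
  · rintro _ ⟨t, ht, rfl⟩
    exact lagrangeVec_mem_extremePoints h2 hx ht
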